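/- **Setting.** A seller has $k$ identical items and faces $n\ge 1$ unit-demand buyers, whose valuations $v_1,\dots,v_n$ are drawn i.i.d. from a distribution $F$ on $\mathbb{R}_+$. The distribution $F$ has a density $f$ that is positive exactly on $[\underline v,\overline v]$, $0\le\underline v<\overline v\le\infty$ (read as $[\underline v,\infty)$ if $\overline v=\infty$), and for some $\lambda\in[0,1)$ it is $\lambda$-regular, i.e. $\lambda v-\frac{1-F(v)}{f(v)}$ is non-decreasing on $[\underline v,\overline v]$. A demand structure $(m,\pi)$ consists of $m$ intermediaries and a partition of $[n]$ into the sets $\pi(1),\dots,\pi(m)$ of buyers that they represent. Intermediary $l$ knows the valuations ${\bm v}_l=(v_i)_{i\in\pi(l)}$, and for $x$ items at total price $p$ its utility is $$V(x,p;{\bm v}_l)=\max\Big\{\sum_{i\in\pi(l)}v_iz_i\;:\;z\in[0,1]^{\pi(l)},\ \sum_{i\in\pi(l)}z_i\le x\Big\}-p .$$ A direct mechanism maps every profile in $[\underline v,\overline v]^n$, measurably, to a lottery over allocations $(x_l)_{l\in[m]}\in\{0,\dots,k\}^m$ and to payments $p_l\ge 0$. It is called BIC if $\sum_l x_l\le k$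 almost surely and if, for every intermediary $l$ and every type ${\bm v}_l$, the interim expected utility of reporting ${\bm v}_l$ truthfully (the others being truthful) is at least that of reporting any other type ${\bm v}_l'$, and is at least $0$. $\mathrm{Rev}(F,m,\pi)$ is the supremum of $\mathbb{E}\big[\sum_l p_l({\bm v})\big]$ over all BIC mechanisms. Write $\mathrm{Rev}^C$ for its value under full competition ($m=n$, $\pi(l)=\{l\}$) and $\mathrm{Rev}^M$ for its value under monopsony ($m=1$, $\pi(1)=[n]$). **Corollary.** There are instances with $k=n$ in which the seller's optimal revenue under monopsony strictly exceeds the optimal revenue under full competition: there exist $n=k\ge 1$ and a distribution $F$ as above with $\mathrm{Rev}^M>\mathrm{Rev}^C$. -/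

import Mathlib

open MeasureTheory Set
open scoped ENNReal NNReal

noncomputable section

namespace Intermediaries

/-- A valuation distribution `F`: it has a density `f` that is positive exactly on the interval
`[lo, hi]`, where `0 ≤ lo < hi ≤ ∞`. -/
structure ValuationDist where
  lo : ℝ
  hi : EReal
  f : ℝ → ℝ
  lo_nonneg : 0 ≤ lo
  lo_lt_hi : (lo : EReal) < hi
  measurable_f : Measurable f
  f_pos : ∀ v : ℝ, lo ≤ v → (v : EReal) ≤ hi → 0 < f v
  f_eq_zero : ∀ v : ℝ, ¬ (lo ≤ v ∧ (v : EReal) ≤ hi) → f v = 0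
  lintegral_f : ∫⁻ v, ENNReal.ofReal (f v) = 1

namespace ValuationDist

/-- The interval `[lo, hi]` (which is `[lo, ∞)` if `hi = ∞`). -/
def supp (F : ValuationDist) : Set ℝ := {v | F.lo ≤ v ∧ (v : EReal) ≤ F.hi}

/-- The law of one buyer's valuation. -/
def law (F : ValuationDist) : Measure ℝ := volume.withDensity (fun v => ENNReal.ofReal (F.f v))

/-- The cumulative distribution function `F(v) = ℙ[value ≤ v]`. -/
def cdf (F : ValuationDist) (v : ℝ) : ℝ := F.law.real (Iic v)

/-- `lam`-regularity: `lam * v - (1 - F(v)) / f(v)` is non-decreasing on the support. For `lam = 0`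
this is the monotone hazard rate condition, for `lam = 1` it is Myerson's regularity. -/
def IsRegular (F : ValuationDist) (lam : ℝ) : Prop :=
  MonotoneOn (fun v => lam * v - (1 - F.cdf v) / F.f v) F.supp

/-- The law of the profile of `n` independent valuations drawn from `F`. -/
def profileLaw (F : ValuationDist) (n : ℕ) : Measure (Fin n → ℝ) := Measure.pi fun _ => F.law

/-- The valuation profiles all of whose entries lie in the support of `F`. -/
def box (F : ValuationDist) (n : ℕ) : Set (Fin n → ℝ) := {v | ∀ i, v i ∈ F.supp}

end ValuationDist

/-- A demand structure `(m, π)` for `n` buyers: `m` intermediaries and a partition of the buyers,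
`π l` being the set of buyers represented by intermediary `l`. -/
structure DemandStructure (n : ℕ) where
  m : ℕ
  π : Fin m → Finset (Fin n)
  nonempty : ∀ l, (π l).Nonempty
  disjoint : ∀ l l', l ≠ l' → Disjoint (π l) (π l')
  cover : ∀ i, ∃ l, i ∈ π l

/-- Full competition: every buyer bids for himself. -/
def competition (n : ℕ) : DemandStructure n where
  m := n
  π := fun l => {l}
  nonempty := fun l => Finset.singleton_nonempty l
  disjoint := fun _ _ h => Finset.disjoint_singleton.2 h
  cover := fun i => ⟨i, Finset.mem_singleton_self i⟩

/-- Monopsony: one intermediary represents all (at least one) buyers. -/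
def monopsony (n : ℕ) (hn : 0 < n) : DemandStructure n where
  m := 1
  π := fun _ => Finset.univ
  nonempty := fun _ => ⟨⟨0, hn⟩, Finset.mem_univ _⟩
  disjoint := fun l l' h => absurd (Subsingleton.elim l l') h
  cover := fun i => ⟨0, Finset.mem_univ i⟩

/-- The largest surplus that `a` items generate among the unit-demand buyers in `S`:
`max {∑ i ∈ S, v i * z i | z ∈ [0,1]^S, ∑ i ∈ S, z i ≤ a}`. -/
def surplus {n : ℕ} (S : Finset (Fin n)) (a : ℕ) (v : Fin n → ℝ) : ℝ :=
  sSup {y | ∃ z : Fin n → ℝ, (∀ i ∈ S, z i ∈ Icc (0 : ℝ) 1) ∧ ∑ i ∈ S, z i ≤ (a : ℝ) ∧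
    y = ∑ i ∈ S, v i * z i}

/-- The utility `V` of a surplus-maximizing intermediary that represents `S`, receives `a` items
and pays `p`. It depends on `v` only through the entries in `S`. -/
def utility {n : ℕ} (S : Finset (Fin n)) (a : ℕ) (p : ℝ) (v : Fin n → ℝ) : ℝ :=
  surplus S a v - p

/-- A direct mechanism for the sale of `k` items: each reported profile is mapped to a lottery over
allocations (`a l` items for intermediary `l`) and to a nonnegative payment of each intermediary.
Only the values on profiles in the box of the distribution matter. -/
structure Mechanism {n : ℕ} (D : DemandStructure n) (k : ℕ) where
  x : (Fin n → ℝ) → PMF (Fin D.m → Fin (k + 1))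
  p : Fin D.m → (Fin n → ℝ) → ℝ≥0
  measurable_x : ∀ a, Measurable fun v => x v a
  measurable_p : ∀ l, Measurable (p l)

namespace Mechanism

variable {n : ℕ} {D : DemandStructure n} {k : ℕ}

/-- The profile that intermediary `l`, reporting `r`, and the others, with valuations `w`, submit:
`r` on `π l` and `w` elsewhere. -/
def submitted (l : Fin D.m) (r w : Fin n → ℝ) : Fin n → ℝ := (D.π l).piecewise r w

/-- The expected utility, over the lottery of the mechanism, of intermediary `l` with true
valuations `t` when the submitted profile is `v`. -/
def lotteryUtility (M : Mechanism D k) (l : Fin D.m) (t v : Fin n → ℝ) : ℝ :=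
  ∑ a, (M.x v a).toReal * utility (D.π l) (a l : ℕ) (M.p l v) t

/-- The interim expected utility of intermediary `l` with true valuations `t` that reports `r`
while the others report truthfully. Since the valuations are independent, this is the conditional
expectation given the valuations `t` in `π l`. Only the entries of `t` and `r` in `π l` matter. -/
def interimUtility (F : ValuationDist) (M : Mechanism D k) (l : Fin D.m) (t r : Fin n → ℝ) : ℝ :=
  ∫ w, M.lotteryUtility l t (submitted l r w) ∂(F.profileLaw n)

/-- Bayesian incentive compatible, individually rational and feasible mechanisms. The field
`integrable` says that interim payments are finite, without which interim utility is `-∞`. -/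
structure IsBIC (F : ValuationDist) (M : Mechanism D k) : Prop where
  integrable : ∀ l, ∀ r ∈ F.box n,
    Integrable (fun w => (M.p l (submitted l r w) : ℝ)) (F.profileLaw n)
  ic : ∀ l, ∀ t ∈ F.box n, ∀ r ∈ F.box n, M.interimUtility F l t r ≤ M.interimUtility F l t t
  ir : ∀ l, ∀ t ∈ F.box n, 0 ≤ M.interimUtility F l t t
  feasible : ∀ᵐ v ∂(F.profileLaw n), ∀ a ∈ (M.x v).support, ∑ l, (a l : ℕ) ≤ k

/-- The seller's expected revenue under truthful reports. -/
def revenue (F : ValuationDist) (M : Mechanism D k) : ℝ≥0∞ :=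
  ∫⁻ v, ∑ l, (M.p l v : ℝ≥0∞) ∂(F.profileLaw n)

end Mechanism

/-- The optimal expected revenue `Rev(F, m, π)` from `k` items. -/
def optRev (F : ValuationDist) {n : ℕ} (D : DemandStructure n) (k : ℕ) : ℝ≥0∞ :=
  ⨆ (M : Mechanism D k) (_ : M.IsBIC F), M.revenue F

end Intermediaries

end

namespace Intermediaries

/-! ### The uniform distribution -/

/-! With an item for every buyer, competing buyers do not constrain each other, so the seller gains
from each only what a single-buyer sale yields. A monopsonist values the bundle at the sum of the
valuations, which concentrates, so a bundle price well above the sum of the lowest values is still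
accepted almost always. The instance is two buyers uniform on `[20, 40]`. A discretized Myerson
argument (`sum_grid_payment_le`) bounds each expected payment by 21, hence competition by 42. The
bundle at price 45 sells with probability at least 15/16 (`one_sub_pow_le_profileLaw_uniformDist`),
which yields at least 42.1875. -/

/-- The uniform distribution on `[a, b]`. -/
noncomputable def uniformDist (a b : ℝ) (ha : 0 ≤ a) (hab : a < b) : ValuationDist where
  lo := a
  hi := (b : EReal)
  f := (Icc a b).indicator fun _ => (b - a)⁻¹
  lo_nonneg := ha
  lo_lt_hi := EReal.coe_lt_coe_iff.2 hab
  measurable_f := measurable_const.indicator measurableSet_Icc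
  f_pos := fun v h₁ h₂ => by
    rw [indicator_of_mem (mem_Icc.2 ⟨h₁, EReal.coe_le_coe_iff.1 h₂⟩)]
    exact inv_pos.2 (sub_pos.2 hab)
  f_eq_zero := fun v h =>
    indicator_of_notMem (fun hv => h ⟨hv.1, EReal.coe_le_coe_iff.2 hv.2⟩) _
  lintegral_f := by
    have h : (fun v => ENNReal.ofReal ((Icc a b).indicator (fun _ => (b - a)⁻¹) v)) =
        (Icc a b).indicator fun _ => ENNReal.ofReal (b - a)⁻¹ := by
      ext v
      by_cases hv : v ∈ Icc a b <;> simp [hv]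
    rw [h, lintegral_indicator measurableSet_Icc, lintegral_const, Measure.restrict_apply_univ,
      Real.volume_Icc, ← ENNReal.ofReal_mul (inv_nonneg.2 (sub_pos.2 hab).le),
      inv_mul_cancel₀ (sub_pos.2 hab).ne', ENNReal.ofReal_one]

section Uniform

variable {a b : ℝ} {ha : 0 ≤ a} {hab : a < b}

theorem uniformDist_supp : (uniformDist a b ha hab).supp = Icc a b := by
  ext v
  simp [ValuationDist.supp, uniformDist]

theorem uniformDist_law : (uniformDist a b ha hab).law =
    ENNReal.ofReal (b - a)⁻¹ • volume.restrict (Icc a b) := by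
  have h : (fun v => ENNReal.ofReal ((uniformDist a b ha hab).f v)) =
      (Icc a b).indicator fun _ => ENNReal.ofReal (b - a)⁻¹ := by
    ext v
    by_cases hv : v ∈ Icc a b <;> simp [uniformDist, hv]
  rw [ValuationDist.law, h, withDensity_indicator measurableSet_Icc, withDensity_const]

instance (F : ValuationDist) : IsProbabilityMeasure F.law :=
  ⟨by rw [ValuationDist.law, withDensity_apply _ MeasurableSet.univ, Measure.restrict_univ,
    F.lintegral_f]⟩

instance (F : ValuationDist) (n : ℕ) : IsProbabilityMeasure (F.profileLaw n) := by
  unfold ValuationDist.profileLaw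
  infer_instance

/-- The density is constant, so the inverse hazard rate is a positive multiple of `1 - cdf`. -/
theorem uniformDist_isRegular : (uniformDist a b ha hab).IsRegular 0 := by
  intro v hv w hw hvw
  rw [uniformDist_supp] at hv hw
  have h : (uniformDist a b ha hab).cdf v ≤ (uniformDist a b ha hab).cdf w :=
    measureReal_mono (Iic_subset_Iic.2 hvw)
  have hba : 0 ≤ b - a := (sub_pos.2 hab).le
  simp only [uniformDist, indicator_of_mem hv, indicator_of_mem hw, zero_mul, zero_sub, div_inv_eq_mul] at h ⊢
  gcongr

theorem uniformDist_law_Iio {s : ℝ} (h₂ : s ≤ b) :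
    (uniformDist a b ha hab).law (Iio s) = ENNReal.ofReal ((s - a) / (b - a)) := by
  have h : Iio s ∩ Icc a b = Ico a s := by
    ext v
    simp only [mem_inter_iff, mem_Iio, mem_Icc, mem_Ico]
    constructor
    · rintro ⟨h, h', -⟩
      exact ⟨h', h⟩
    · rintro ⟨h, h'⟩
      exact ⟨h', h, h'.le.trans h₂⟩
  rw [uniformDist_law, Measure.smul_apply, Measure.restrict_apply measurableSet_Iio, h,
    Real.volume_Ico, smul_eq_mul, ← ENNReal.ofReal_mul (inv_nonneg.2 (sub_pos.2 hab).le),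
    inv_mul_eq_div]

end Uniform

/-! ### Surplus of surplus-maximizing intermediaries -/

section Surplus

variable {n : ℕ}

theorem surplus_zero (S : Finset (Fin n)) (v : Fin n → ℝ) : surplus S 0 v = 0 := by
  apply IsGreatest.csSup_eq
  refine ⟨⟨0, by simp, by simp, by simp⟩, ?_⟩
  rintro y ⟨z, hz, hs, rfl⟩
  have hs' : ∑ i ∈ S, z i = 0 := le_antisymm (by simpa using hs)
    (Finset.sum_nonneg fun i hi => (hz i hi).1)
  rw [Finset.sum_eq_zero_iff_of_nonneg fun i hi => (hz i hi).1] at hs'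
  exact (Finset.sum_eq_zero fun i hi => by rw [hs' i hi, mul_zero]).le

theorem surplus_of_card_le {S : Finset (Fin n)} {a : ℕ} (h : S.card ≤ a) {v : Fin n → ℝ}
    (hv : ∀ i ∈ S, 0 ≤ v i) : surplus S a v = ∑ i ∈ S, v i := by
  apply IsGreatest.csSup_eq
  refine ⟨⟨1, by simp, by simpa using h, by simp⟩, ?_⟩
  rintro y ⟨z, hz, -, rfl⟩
  exact Finset.sum_le_sum fun i hi => mul_le_of_le_one_right (hv i hi) (hz i hi).2

theorem surplus_singleton {l : Fin n} (a : ℕ) {v : Fin n → ℝ} (hv : 0 ≤ v l) :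
    surplus {l} a v = v l * (min a 1 : ℕ) := by
  rcases Nat.eq_zero_or_pos a with rfl | ha
  · simp [surplus_zero]
  · rw [surplus_of_card_le ((Finset.card_singleton l).trans_le ha) (by simpa using hv), min_eq_right ha]
    simp

end Surplus

/-! ### Full competition -/

/-- A product measure is not changed by resampling one coordinate. -/
theorem lintegral_pi_eq_lintegral_update {ι : Type*} [Fintype ι] [DecidableEq ι] (μ : Measure ℝ)
    [IsProbabilityMeasure μ] (i : ι) {f : (ι → ℝ) → ℝ≥0∞} (hf : Measurable f) :
    ∫⁻ v, f v ∂(Measure.pi fun _ => μ) =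
      ∫⁻ s, ∫⁻ w, f (Function.update w i s) ∂(Measure.pi fun _ => μ) ∂μ := by
  have hm : Measurable fun p : (ι → ℝ) × ℝ => f (Function.update p.1 i p.2) :=
    hf.comp measurable_update'
  have hG : Measurable fun w => ∫⁻ s, f (Function.update w i s) ∂μ := hm.lintegral_prod_right'
  have hs : AEMeasurable (Function.uncurry fun s w => f (Function.update w i s))
      (μ.prod (Measure.pi fun _ => μ)) := (hm.comp measurable_swap).aemeasurable
  rw [lintegral_lintegral_swap hs]
  -- Integrating out coordinate `i` first turns both sides into the same iterated integral, since
  -- the inner integral on the right no longer depends on `w i`. The base point `0` is arbitrary.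
  rw [lintegral_eq_lmarginal_univ (μ := fun _ => μ) 0, lintegral_eq_lmarginal_univ (μ := fun _ => μ) 0,
    lmarginal_erase' _ hf (Finset.mem_univ i), lmarginal_erase' _ hG (Finset.mem_univ i)]
  simp

/-- Discrete Myerson bound for types `N, N + 1, ..., 2N`, where `hp` says that no type gains by
imitating the one just below. Summation by parts gives the increment of `q` at type `N + m + 1` the
weight `(N - m) * (N + m + 1) = N * (N + 1) - m * (m + 1)`: price times number of buying types,
largest at the bottom. -/
theorem sum_grid_payment_le {N : ℕ} {p q : ℕ → ℝ} (h0 : p 0 ≤ N * q 0) (hp0 : 0 ≤ p 0)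
    (hp : ∀ i < N, p (i + 1) - p i ≤ (N + (i + 1)) * (q (i + 1) - q i))
    (hq : ∀ i < N, q i ≤ q (i + 1)) (hN : q N ≤ 1) :
    ∑ i ∈ Finset.range N, p (i + 1) ≤ N * (N + 1) := by
  -- The term `(N - m) * p m` charges the `N - m` grid types not yet summed the current payment.
  have key : ∀ m ≤ N,
      ∑ i ∈ Finset.range m, p (i + 1) + (N - m) * p m ≤ N * (N + 1) * q m := by
    intro m
    induction m with
    | zero =>
      intro _
      have : (0 : ℝ) ≤ N := N.cast_nonneg
      simp only [Finset.range_zero, Finset.sum_empty, Nat.cast_zero]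
      nlinarith
    | succ m ih =>
      intro hm
      have hm' : (m : ℝ) + 1 ≤ N := by exact_mod_cast hm
      have h₁ := ih (by omega)
      have h₂ := mul_le_mul_of_nonneg_left (hp m hm) (show (0 : ℝ) ≤ N - m by linarith)
      have h₃ : (0 : ℝ) ≤ (m * (m + 1)) * (q (m + 1) - q m) :=
        mul_nonneg (by positivity) (sub_nonneg.2 (hq m hm))
      rw [Finset.sum_range_succ]
      push_cast
      linarith
  have h := key N le_rfl
  rw [sub_self, zero_mul, add_zero] at h
  exact h.trans (mul_le_of_le_one_right (by positivity) hN)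

/-! ### Interim winning probabilities and payments of a single buyer -/

namespace Mechanism

variable {n k : ℕ}

/-- The interim probability of winning an item for the single buyer `l` who reports `s`. -/
noncomputable def winProb (F : ValuationDist) (M : Mechanism (competition n) k) (l : Fin n) (s : ℝ) : ℝ :=
  ∫ w, ∑ a, (M.x (Function.update w l s) a).toReal * (min (a l : ℕ) 1 : ℕ) ∂(F.profileLaw n)

/-- The interim payment of the single buyer `l` who reports `s`. -/
noncomputable def interimPayment (F : ValuationDist) (M : Mechanism (competition n) k) (l : Fin n)
    (s : ℝ) : ℝ :=
  ∫ w, (M.p l (Function.update w l s) : ℝ) ∂(F.profileLaw n)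

theorem submitted_competition (l : Fin n) (r w : Fin n → ℝ) :
    submitted (D := competition n) l r w = Function.update w l (r l) :=
  Finset.piecewise_singleton r w l

theorem sum_toReal_eq_one {D : DemandStructure n} (M : Mechanism D k) (v : Fin n → ℝ) :
    ∑ a, (M.x v a).toReal = 1 := by
  rw [← ENNReal.toReal_sum fun a _ => (M.x v).apply_ne_top a, ← ENNReal.toReal_one,
    ← (M.x v).tsum_coe, tsum_fintype]

variable (M : Mechanism (competition n) k)

theorem sum_win_nonneg (l : Fin n) (v : Fin n → ℝ) :
    0 ≤ ∑ a, (M.x v a).toReal * (min (a l : ℕ) 1 : ℕ) :=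
  Finset.sum_nonneg fun _ _ => by positivity

theorem sum_win_le_one (l : Fin n) (v : Fin n → ℝ) :
    ∑ a, (M.x v a).toReal * (min (a l : ℕ) 1 : ℕ) ≤ 1 := by
  rw [← M.sum_toReal_eq_one v]
  exact Finset.sum_le_sum fun a _ =>
    mul_le_of_le_one_right ENNReal.toReal_nonneg (by exact_mod_cast min_le_right _ _)

variable {F : ValuationDist}

theorem integrable_sum_win (l : Fin n) (s : ℝ) :
    Integrable (fun w => ∑ a, (M.x (Function.update w l s) a).toReal * (min (a l : ℕ) 1 : ℕ))
      (F.profileLaw n) := by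
  refine Integrable.of_bound (C := 1) (Measurable.aestronglyMeasurable ?_) (ae_of_all _ fun w => ?_)
  · exact Finset.measurable_sum _ fun a _ =>
      (((M.measurable_x a).comp measurable_update_left).ennreal_toReal).mul_const _
  · rw [Real.norm_of_nonneg (M.sum_win_nonneg l _)]
    exact M.sum_win_le_one l _

theorem winProb_le_one (l : Fin n) (s : ℝ) : M.winProb F l s ≤ 1 := by
  simpa [winProb] using integral_mono (M.integrable_sum_win l s) (integrable_const (μ := F.profileLaw n) (1 : ℝ))
    fun w => M.sum_win_le_one l _

theorem interimPayment_nonneg (l : Fin n) (s : ℝ) : 0 ≤ M.interimPayment F l s :=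
  integral_nonneg fun _ => NNReal.coe_nonneg _

variable {M}

theorem IsBIC.integrable_payment (h : M.IsBIC F) (l : Fin n) {s : ℝ} (hs : s ∈ F.supp) :
    Integrable (fun w => (M.p l (Function.update w l s) : ℝ)) (F.profileLaw n) := by
  simpa only [submitted_competition] using h.integrable l (fun _ => s) fun _ => hs

theorem IsBIC.interimUtility_competition (h : M.IsBIC F) (l : Fin n) {t r : Fin n → ℝ} (ht : 0 ≤ t l)
    (hr : r l ∈ F.supp) :
    M.interimUtility F l t r = t l * M.winProb F l (r l) - M.interimPayment F l (r l) := by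
  rw [winProb, interimPayment, ← integral_const_mul,
    ← integral_sub ((M.integrable_sum_win l _).const_mul _) (h.integrable_payment l hr)]
  refine integral_congr_ae (ae_of_all _ fun w => ?_)
  simp only [submitted_competition]
  have hu : ∀ (a : Fin n → Fin (k + 1)) (p : ℝ),
      utility ((competition n).π l) (a l : ℕ) p t = t l * (min (a l : ℕ) 1 : ℕ) - p :=
    fun a p => congrArg (· - p) (surplus_singleton _ ht)
  calc _ = ∑ a, ((M.x (Function.update w l (r l)) a).toReal * (t l * (min (a l : ℕ) 1 : ℕ)) -
        (M.x (Function.update w l (r l)) a).toReal * M.p l (Function.update w l (r l))) :=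
        Finset.sum_congr rfl fun a _ => by rw [← mul_sub]; exact congrArg _ (hu a _)
    _ = _ := by
      rw [Finset.sum_sub_distrib, ← Finset.sum_mul, M.sum_toReal_eq_one, one_mul, Finset.mul_sum]
      exact congrArg (· - _) (Finset.sum_congr rfl fun a _ => by ring)

theorem IsBIC.competition_ic (h : M.IsBIC F) (l : Fin n) {t r : ℝ} (ht : t ∈ F.supp) (hr : r ∈ F.supp) :
    t * M.winProb F l r - M.interimPayment F l r ≤ t * M.winProb F l t - M.interimPayment F l t := by
  have ht0 : 0 ≤ t := F.lo_nonneg.trans ht.1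
  have := h.ic l (fun _ => t) (fun _ => ht) (fun _ => r) (fun _ => hr)
  rwa [h.interimUtility_competition l ht0 hr, h.interimUtility_competition l ht0 ht] at this

theorem IsBIC.competition_ir (h : M.IsBIC F) (l : Fin n) {t : ℝ} (ht : t ∈ F.supp) :
    M.interimPayment F l t ≤ t * M.winProb F l t := by
  have := h.ir l (fun _ => t) (fun _ => ht)
  rw [h.interimUtility_competition l (F.lo_nonneg.trans ht.1) ht] at this
  exact sub_nonneg.1 this

/-- Adding the two incentive constraints between `r` and `t` gives `(t - r) * (q t - q r) ≥ 0`, with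
`q` the winning probability. -/
theorem IsBIC.winProb_monotoneOn (h : M.IsBIC F) (l : Fin n) : MonotoneOn (M.winProb F l) F.supp := by
  intro r hr t ht hrt
  rcases hrt.eq_or_lt with rfl | hlt
  · rfl
  have h₁ := h.competition_ic l ht hr
  have h₂ := h.competition_ic l hr ht
  by_contra! hq
  nlinarith

/-- If the higher report were cheaper, the lower type would imitate it, as it wins at least as
often. -/
theorem IsBIC.interimPayment_monotoneOn (h : M.IsBIC F) (l : Fin n) :
    MonotoneOn (M.interimPayment F l) F.supp := by
  intro r hr t ht hrt
  have h₁ := h.competition_ic l hr ht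
  have h₂ := mul_le_mul_of_nonneg_left (h.winProb_monotoneOn l hr ht hrt) (F.lo_nonneg.trans hr.1)
  linarith

/-- Links revenue to incentives. Integrability is essential: a divergent Bochner integral would be
`0`. -/
theorem IsBIC.lintegral_payment (h : M.IsBIC F) (l : Fin n) {s : ℝ} (hs : s ∈ F.supp) :
    ∫⁻ w, (M.p l (Function.update w l s) : ℝ≥0∞) ∂(F.profileLaw n) =
      ENNReal.ofReal (M.interimPayment F l s) := by
  rw [interimPayment, ofReal_integral_eq_lintegral_ofReal (h.integrable_payment l hs)
    (ae_of_all _ fun _ => NNReal.coe_nonneg _)]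
  simp

end Mechanism

namespace Mechanism

variable {n k N : ℕ} {M : Mechanism (competition n) k}

/-- A single buyer with valuation uniform on `[N, 2N]` pays at most `N + 1` in expectation. -/
theorem IsBIC.lintegral_payment_uniformDist_le {h0 : (0 : ℝ) ≤ N} {h1 : (N : ℝ) < N + N}
    (h : M.IsBIC (uniformDist N (N + N) h0 h1)) (l : Fin n) :
    ∫⁻ v, (M.p l v : ℝ≥0∞) ∂((uniformDist N (N + N) h0 h1).profileLaw n) ≤
      ENNReal.ofReal (N + 1) := by
  set F := uniformDist N (N + N) h0 h1
  have hsupp : F.supp = Icc (N : ℝ) (N + N) := uniformDist_supp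
  have hN : (0 : ℝ) < N := by linarith
  have hmono := h.interimPayment_monotoneOn l
  have hmem : ∀ i ≤ N, (N : ℝ) + i ∈ F.supp := fun i hi => by
    rw [hsupp]
    exact ⟨by simp, by gcongr⟩
  have hgrid : ∑ i ∈ Finset.range N, M.interimPayment F l (N + (i + 1 : ℕ)) ≤ N * (N + 1) := by
    refine sum_grid_payment_le (p := fun i => M.interimPayment F l (N + i))
      (q := fun i => M.winProb F l (N + i)) ?_ (M.interimPayment_nonneg l _) ?_ ?_
      (M.winProb_le_one l _)
    · simpa using h.competition_ir l (hmem 0 N.zero_le)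
    · intro i hi
      have := h.competition_ic l (hmem (i + 1) hi) (hmem i hi.le)
      push_cast at this ⊢
      linarith
    · intro i hi
      exact h.winProb_monotoneOn l (hmem i hi.le) (hmem (i + 1) hi) (by simp)
  rw [hsupp] at hmono
  have hint : ∫ s in Icc (N : ℝ) (N + N), M.interimPayment F l s ≤ N * (N + 1) := by
    rw [integral_Icc_eq_integral_Ioc, ← intervalIntegral.integral_of_le (by linarith)]
    -- Payments increase with the type, so the sum over right endpoints of unit cells dominates the
    -- integral.
    exact hmono.integral_le_sum.trans hgrid
  have hmeas : Measurable fun v => (M.p l v : ℝ≥0∞) := (M.measurable_p l).coe_nnreal_ennreal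
  have hlaw : F.law = ENNReal.ofReal (N : ℝ)⁻¹ • volume.restrict (Icc (N : ℝ) (N + N)) := by
    rw [uniformDist_law, add_sub_cancel_left]
  calc ∫⁻ v, (M.p l v : ℝ≥0∞) ∂(F.profileLaw n)
      = ∫⁻ s, ∫⁻ w, (M.p l (Function.update w l s) : ℝ≥0∞) ∂(F.profileLaw n) ∂F.law :=
        lintegral_pi_eq_lintegral_update F.law l hmeas
    _ = ENNReal.ofReal (N : ℝ)⁻¹ *
          ∫⁻ s in Icc (N : ℝ) (N + N), ENNReal.ofReal (M.interimPayment F l s) := by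
        rw [hlaw, lintegral_smul_measure, smul_eq_mul]
        congr 1
        exact setLIntegral_congr_fun measurableSet_Icc fun s hs =>
          h.lintegral_payment l (hsupp ▸ hs)
    _ = ENNReal.ofReal ((N : ℝ)⁻¹ * ∫ s in Icc (N : ℝ) (N + N), M.interimPayment F l s) := by
        rw [← ofReal_integral_eq_lintegral_ofReal (hmono.integrableOn_isCompact isCompact_Icc)
          (ae_of_all _ fun s => M.interimPayment_nonneg l s),
          ENNReal.ofReal_mul (inv_nonneg.2 hN.le)]
    _ ≤ ENNReal.ofReal (N + 1) := by
        apply ENNReal.ofReal_le_ofReal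
        rw [inv_mul_le_iff₀ hN]
        exact hint

end Mechanism

theorem optRev_competition_uniformDist_le (n k N : ℕ) (h0 : (0 : ℝ) ≤ N) (h1 : (N : ℝ) < N + N) :
    optRev (uniformDist N (N + N) h0 h1) (competition n) k ≤ n * ENNReal.ofReal (N + 1) := by
  refine iSup₂_le fun M hM => ?_
  rw [Mechanism.revenue,
    lintegral_finsetSum _ fun l _ => (M.measurable_p l).coe_nnreal_ennreal]
  calc _ ≤ ∑ _l : Fin n, ENNReal.ofReal (N + 1) :=
        Finset.sum_le_sum fun l _ => hM.lintegral_payment_uniformDist_le l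
    _ = _ := by simp

/-! ### Bundling under monopsony -/

open scoped Classical in
/-- The mechanism that offers all `n` items as a bundle at the price `P` to the single
intermediary, who accepts if the sum of the valuations is at least `P`. -/
noncomputable def bundling (n : ℕ) (hn : 0 < n) (P : ℝ≥0) : Mechanism (monopsony n hn) n where
  x := fun v => if (P : ℝ) ≤ ∑ i, v i then PMF.pure fun _ => Fin.last n else PMF.pure fun _ => 0
  p := fun _ v => if (P : ℝ) ≤ ∑ i, v i then P else 0
  measurable_x := fun a => by
    have hm : MeasurableSet {v : Fin n → ℝ | (P : ℝ) ≤ ∑ i, v i} :=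
      measurableSet_le measurable_const (by fun_prop)
    have : (fun v : Fin n → ℝ => (if (P : ℝ) ≤ ∑ i, v i then
        (PMF.pure fun _ => Fin.last n : PMF (Fin (monopsony n hn).m → Fin (n + 1)))
        else PMF.pure fun _ => 0) a) =
        fun v => if (P : ℝ) ≤ ∑ i, v i then
          (PMF.pure fun _ => Fin.last n : PMF (Fin (monopsony n hn).m → Fin (n + 1))) a
          else (PMF.pure fun _ => 0 : PMF (Fin (monopsony n hn).m → Fin (n + 1))) a := by
      ext v
      split_ifs <;> rfl
    rw [this]
    exact Measurable.ite hm measurable_const measurable_const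
  measurable_p := fun _ =>
    Measurable.ite (measurableSet_le measurable_const (by fun_prop)) measurable_const
      measurable_const

section Bundling

variable {n : ℕ} {hn : 0 < n} {P : ℝ≥0}

theorem submitted_monopsony (l : Fin (monopsony n hn).m) (r w : Fin n → ℝ) :
    Mechanism.submitted l r w = r :=
  Finset.piecewise_univ r w

theorem bundling_interimUtility (F : ValuationDist) (l : Fin (monopsony n hn).m) {t : Fin n → ℝ}
    (ht : ∀ i, 0 ≤ t i) (r : Fin n → ℝ) :
    (bundling n hn P).interimUtility F l t r = if (P : ℝ) ≤ ∑ i, r i then ∑ i, t i - P else 0 := by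
  have hS : (monopsony n hn).π l = Finset.univ := rfl
  simp only [Mechanism.interimUtility, submitted_monopsony, integral_const, probReal_univ, one_smul,
    Mechanism.lotteryUtility, utility, hS]
  by_cases h : (P : ℝ) ≤ ∑ i, r i
  · simp only [bundling, h, if_true, PMF.pure_apply]
    rw [Finset.sum_eq_single (fun _ => Fin.last n) (fun a _ ha => by simp [ha])
      (fun h => absurd (Finset.mem_univ _) h)]
    simp [surplus_of_card_le (S := Finset.univ) (a := n) (by simp) fun i _ => ht i]
  · simp only [bundling, h, if_false, PMF.pure_apply]
    rw [Finset.sum_eq_single (fun _ => 0) (fun a _ ha => by simp [ha])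
      (fun h => absurd (Finset.mem_univ _) h)]
    simp [surplus_zero]

theorem bundling_isBIC (F : ValuationDist) : (bundling n hn P).IsBIC F where
  integrable := fun l r _ => by
    simp only [submitted_monopsony]
    exact integrable_const _
  ic := fun l t ht r _ => by
    have ht' : ∀ i, 0 ≤ t i := fun i => F.lo_nonneg.trans (ht i).1
    rw [bundling_interimUtility F l ht', bundling_interimUtility F l ht']
    split_ifs <;> linarith
  ir := fun l t ht => by
    rw [bundling_interimUtility F l fun i => F.lo_nonneg.trans (ht i).1]
    split_ifs with h
    · exact sub_nonneg.2 h
    · rfl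
  feasible := ae_of_all _ fun v a _ => by
    have : ∑ l, (a l : ℕ) = (a (0 : Fin 1) : ℕ) := Fin.sum_univ_one fun l : Fin 1 => (a l : ℕ)
    rw [this]
    exact Fin.is_le _

theorem bundling_revenue (F : ValuationDist) :
    (bundling n hn P).revenue F = P * F.profileLaw n {v | (P : ℝ) ≤ ∑ i, v i} := by
  have hm : MeasurableSet {v : Fin n → ℝ | (P : ℝ) ≤ ∑ i, v i} :=
    measurableSet_le measurable_const (by fun_prop)
  rw [← lintegral_indicator_const hm]
  refine lintegral_congr fun v => ?_
  refine (Fin.sum_univ_one fun l : Fin 1 => ((bundling n hn P).p l v : ℝ≥0∞)).trans ?_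
  by_cases h : (P : ℝ) ≤ ∑ i, v i <;> simp [bundling, h]

end Bundling

/-- If the sum of `n` valuations uniform on `[a, b]` is below `n * a + s`, each of them is below
`a + s`. -/
theorem one_sub_pow_le_profileLaw_uniformDist {a b : ℝ} (ha : 0 ≤ a) (hab : a < b) (n : ℕ) {s : ℝ}
    (hs : a + s ≤ b) :
    1 - ENNReal.ofReal (s / (b - a)) ^ n ≤
      (uniformDist a b ha hab).profileLaw n {v | n * a + s ≤ ∑ i, v i} := by
  set F := uniformDist a b ha hab
  have hm : MeasurableSet {v : Fin n → ℝ | n * a + s ≤ ∑ i, v i} :=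
    measurableSet_le measurable_const (by fun_prop)
  have hsupp : ∀ᵐ x ∂F.law, a ≤ x := by
    rw [uniformDist_law]
    exact Measure.ae_smul_measure
      ((ae_restrict_mem measurableSet_Icc).mono fun x hx => hx.1) _
  have hae : ∀ᵐ v ∂(F.profileLaw n), ∀ i, a ≤ v i :=
    ae_all_iff.2 fun i => (Measure.tendsto_eval_ae_ae (i := i)).eventually hsupp
  have hbox : F.profileLaw n (univ.pi fun _ => Iio (a + s)) = ENNReal.ofReal (s / (b - a)) ^ n := by
    rw [ValuationDist.profileLaw, Measure.pi_pi, uniformDist_law_Iio hs, add_sub_cancel_left]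
    simp
  have hcompl : F.profileLaw n {v | n * a + s ≤ ∑ i, v i}ᶜ ≤
      F.profileLaw n (univ.pi fun _ => Iio (a + s)) := by
    -- The inclusion needs every `v i ≥ a`, hence holds only almost everywhere.
    refine measure_mono_ae ?_
    filter_upwards [hae] with v hv hlt i _
    have h₁ : ∑ i, (v i - a) < s := by
      have hlt' : ∑ i, v i < n * a + s := not_le.1 hlt
      rw [Finset.sum_sub_distrib, Finset.sum_const, Finset.card_univ, Fintype.card_fin,
        nsmul_eq_mul]
      linarith
    have h₂ : v i - a ≤ ∑ i, (v i - a) :=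
      Finset.single_le_sum (f := fun i => v i - a) (fun j _ => sub_nonneg.2 (hv j))
        (Finset.mem_univ i)
    exact mem_Iio.2 (by linarith)
  rw [hbox, prob_compl_eq_one_sub hm] at hcompl
  exact tsub_le_iff_tsub_le.1 hcompl

end Intermediaries

theorem mainTheorem9 :
    ∃ (n k : ℕ) (hn : 0 < n) (F : Intermediaries.ValuationDist) (lam : ℝ),
      k = n ∧ 0 ≤ lam ∧ lam < 1 ∧ F.IsRegular lam ∧
        Intermediaries.optRev F (Intermediaries.competition n) k <
          Intermediaries.optRev F (Intermediaries.monopsony n hn) k := by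
  have h1 : ((20 : ℕ) : ℝ) < (20 : ℕ) + (20 : ℕ) := by norm_num
  refine ⟨2, 2, two_pos, Intermediaries.uniformDist (20 : ℕ) ((20 : ℕ) + (20 : ℕ)) (Nat.cast_nonneg _) h1,
    0, rfl, le_rfl, one_pos, Intermediaries.uniformDist_isRegular, ?_⟩
  refine (Intermediaries.optRev_competition_uniformDist_le 2 2 20 _ h1).trans_lt ?_
  refine lt_of_lt_of_le ?_
    (le_iSup₂ (Intermediaries.bundling 2 two_pos 45) (Intermediaries.bundling_isBIC _))
  rw [Intermediaries.bundling_revenue]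
  have h := Intermediaries.one_sub_pow_le_profileLaw_uniformDist (Nat.cast_nonneg _) h1 2 (s := 5)
    (by norm_num)
  have hP : ((2 : ℕ) : ℝ) * (20 : ℕ) + 5 = ((45 : ℝ≥0) : ℝ) := by norm_num
  rw [hP] at h
  refine lt_of_lt_of_le ?_ (mul_le_mul_right h _)
  have h₁ : ENNReal.ofReal (5 / (((20 : ℕ) : ℝ) + (20 : ℕ) - (20 : ℕ))) ^ 2 =
      ENNReal.ofReal (1 / 16) := by
    rw [← ENNReal.ofReal_pow (by norm_num)]
    norm_num
  rw [h₁, ← ENNReal.ofReal_one, ← ENNReal.ofReal_sub _ (by norm_num),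
    show ((45 : ℝ≥0) : ℝ≥0∞) = ENNReal.ofReal 45 by simp, ← ENNReal.ofReal_mul (by norm_num),
    show ((2 : ℕ) : ℝ≥0∞) = ENNReal.ofReal 2 by simp, ← ENNReal.ofReal_mul (by norm_num)]
  -- This is `2 * 21 = 42 < 45 * (1 - 1 / 16) = 42.1875`.
  exact (ENNReal.ofReal_lt_ofReal_iff (by norm_num)).2 (by norm_num)
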